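/- Let $K$ be a compact metric space and $\gamma=(\gamma_0,\dots,\gamma_{N-1})$, $N\ge 2$, a family of proper contractions of $K$ (i.e. $c'd(x,y)\le d(\gamma_i(x),\gamma_i(y))\le c\,d(x,y)$ with $0<c'\le c<1$) such that $K=\bigcup_i\gamma_i(K)$. Put $\Sigma=\{0,\dots,N-1\}$ and, for a word $v=(i_1,\dots,i_n)\in\Sigma^n$, $\gamma_v=\gamma_{i_n}\circ\cdots\circ\gamma_{i_1}$; write $\gamma^n=(\gamma_v)_{v\in\Sigma^n}$. Let $B_{\gamma}=\{b: b=\gamma_i(a)=\gamma_j(a)\text{ for some } a\in K,\ i\ne j\}$, let $B_{\gamma^n}$ be the same set formed with $\gamma^n$, and let $P_\gamma=\{a:\gamma_v(a)\in B_\gamma\text{ for some word } v \text{ of length}\ge 1\}$. Assume that there is a continuous $h:K\to K$ with $h\circ\gamma_j=\mathrm{id}$ for all $j$, that $B_\gamma$ is finite, and that $B_\gamma\cap P_\gamma=\emptyset$. Let $A=C(K)$, and let $X=C(\{(\gamma_j(y),y)\})$ be the $A$-$A$ correspondence with $(a\cdot f\cdot b)(\gamma_j(y),y)=a(\gamma_j(y))f(\gamma_j(y),y)b(y)$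 and $(f|g)_A(y)=\sum_j\overline{f(\gamma_j(y),y)}\,g(\gamma_j(y),y)$. Let $X^{\otimes s}$ be its $s$-fold inner tensor power, and let $\varphi:X^{\otimes s}\to A^{N^s}=C(K,\mathbb C^{\Sigma^s})$ be the inner-product preserving embedding determined by $\varphi(f_1\otimes\cdots\otimes f_s)(y)_{(i_1,\dots,i_s)}=\prod_{k=1}^{s}f_{s+1-k}(y_k,y_{k-1})$, where $y_0=y$ and $y_k=\gamma_{i_k}(y_{k-1})$. Let $\Omega^{(s)}:\mathcal K(X^{\otimes s})\to M_{N^s}(A)=C(K,M_{N^s}(\mathbb C))$ be the $*$-homomorphism with $\Omega^{(s)}(\theta_{x,y})=\theta_{\varphi(x),\varphi(y)}=[\varphi(x)_i\overline{\varphi(y)_j}]_{i,j}$. Index the rows and columns of $N^n\times N^n$ matrices by $\Sigma^n$; for $v\in\Sigma^{r}$, $r\le n$, and $D\in M_{N^{n-r}}(\mathbb C)$ let $\pi_{n-r,v}(D)\in M_{N^n}(\mathbb C)$ be the block diagonal matrix whose block at $v$ (on the words with prefix $v$) is $D$ and whose other blocks are $0$. For $T\in\mathcal K(X^{\otimes s})$,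 $s\le n$, the matrix representation $\Pi^{(n)}$ of the $n$-th finite core is given by $$\Pi^{(n)}(T\otimes I)(P)=\sum_{v\in\Sigma^{n-s}}\pi_{s,v}\bigl(\Omega^{(s)}(T)(\gamma_v(P))\bigr).$$ Let $P\in P_\gamma$, $1\le p\le n$, $q=n-p$, and let $R\in B_\gamma$ satisfy $h^p(R)=P$. Let $W$ be the set of words $(i_1,\dots,i_p)\in\Sigma^p$ with $\gamma_{i_{p-1}}\circ\cdots\circ\gamma_{i_1}(P)=h(R)$ and $\gamma_{i_p}(h(R))=R$, and put $$\tilde C(P,R,p)=\Bigl\{\sum_{w\in W}\pi_{q,w}(D)\ :\ D\in M_{N^q}(\mathbb C)\Bigr\},\qquad C(P,R,p)=(I-Q_{\gamma^n}(P))\,\tilde C(P,R,p),$$ where $Q_{\gamma^n}(P)$ is the orthogonal projection of $\mathbb C^{N^n}$ onto $Z_{\gamma^n}(P)=\{f(P): f\in Z_{\gamma^n}\}$, and $Z_{\gamma^n}$ is the set of $f\in C(K,\mathbb C^{\Sigma^n})$ such that $f(c)_v=f(c)_w$ whenever $b\in B_{\gamma^n}$, $c=h^n(b)$ and $\gamma_v(c)=b=\gamma_w(c)$.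 Then for every $s$ with $q+1\le s\le n$, the block algebra $C(P,R,p)$ is orthogonal to the fiber $\Pi^{(n)}(\mathcal K(X^{\otimes s})\otimes I)(P)$: for all $S\in C(P,R,p)$ and all $T\in\Pi^{(n)}(\mathcal K(X^{\otimes s})\otimes I)(P)$ one has $ST=TS=0$. -/

import Mathlib

set_option linter.unusedSectionVars false
set_option linter.unusedVariables false

open scoped Matrix Matrix.Norms.L2Operator

namespace SelfSim

section Dynamics

variable {K : Type*} [MetricSpace K]

/-- A proper contraction: `c' d(x,y) ≤ d(f x, f y) ≤ c d(x,y)` with `0 < c' ≤ c < 1`. -/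
def IsProperContraction (f : K → K) : Prop :=
  ∃ c' c : ℝ, 0 < c' ∧ c' ≤ c ∧ c < 1 ∧
    ∀ x y : K, c' * dist x y ≤ dist (f x) (f y) ∧ dist (f x) (f y) ≤ c * dist x y

/-- `γ = (γ_0, …, γ_{N-1})`, `N ≥ 2`, is a self-similar map on `K`. -/
structure IsSelfSimilar {N : ℕ} (γ : Fin N → C(K, K)) : Prop where
  two_le : 2 ≤ N
  proper : ∀ i, IsProperContraction (γ i)
  cover : ⋃ i, Set.range (γ i) = Set.univ

/-- The branch set `B` of a family of self-maps of `K`. -/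
def branchSet {ι : Type*} (f : ι → C(K, K)) : Set K :=
  {b | ∃ a : K, ∃ i j : ι, i ≠ j ∧ b = f i a ∧ b = f j a}

/-- The branch value set `C` of a family of self-maps of `K`. -/
def branchValueSet {ι : Type*} (f : ι → C(K, K)) : Set K :=
  {a | ∃ i j : ι, i ≠ j ∧ f i a = f j a}

/-- For a word `w = (i_1, …, i_n)` the composition `γ_{i_n} ∘ ⋯ ∘ γ_{i_1}`; so `wordMap γ` on words
of length `n` is the self-similar map `γ^n`. -/
def wordMap {N : ℕ} (γ : Fin N → C(K, K)) : {n : ℕ} → (Fin n → Fin N) → C(K, K)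
  | 0, _ => ContinuousMap.id K
  | _ + 1, w => (wordMap γ (Fin.tail w)).comp (γ (w 0))

/-- The postcritical set `P_γ`. -/
def postcriticalSet {N : ℕ} (γ : Fin N → C(K, K)) : Set K :=
  {a | ∃ k : ℕ, 1 ≤ k ∧ ∃ w : Fin k → Fin N, wordMap γ w a ∈ branchSet γ}

/-- Assumption B, with `h` the common continuous left inverse of the branches. -/
structure AssumptionB {N : ℕ} (γ : Fin N → C(K, K)) (h : C(K, K)) : Prop where
  leftInverse : ∀ (j : Fin N) (y : K), h (γ j y) = y
  finite_branchSet : (branchSet γ).Finite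
  disjoint : branchSet γ ∩ postcriticalSet γ = ∅

end Dynamics

section Words

/-- The first `r` letters of a word of length `n = r + s`. -/
def pre {N r s n : ℕ} (hn : r + s = n) (w : Fin n → Fin N) : Fin r → Fin N :=
  fun k => w ⟨k, by have := k.2; omega⟩

/-- The last `s` letters of a word of length `n = r + s`. -/
def suf {N r s n : ℕ} (hn : r + s = n) (w : Fin n → Fin N) : Fin s → Fin N :=
  fun k => w ⟨r + k, by have := k.2; omega⟩

/-- Square matrices of size `N ^ n`; rows and columns are indexed by the words `i_1 ⋯ i_n`
(instead of the integers with these `N`-adic digits). -/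
abbrev Mat (N n : ℕ) : Type := Matrix (Fin n → Fin N) (Fin n → Fin N) ℂ

/-- `π_{q,w}(A)`: the block diagonal matrix of size `N ^ n`, `n = p + q`, whose `w`-th diagonal block
of size `N ^ q` is `A` and whose other blocks vanish. -/
def blockEmb {N p q n : ℕ} (hn : p + q = n) (w : Fin p → Fin N) (A : Mat N q) : Mat N n :=
  fun a b => if pre hn a = w ∧ pre hn b = w then A (suf hn a) (suf hn b) else 0

end Words

noncomputable section Modules

variable {K : Type*} [MetricSpace K] [CompactSpace K] {N : ℕ}

/-- The cograph `{(γ_j(y), y)}`. -/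
def cograph (γ : Fin N → C(K, K)) : Set (K × K) :=
  {z | ∃ (j : Fin N) (y : K), z = (γ j y, y)}

/-- The correspondence `X_γ = C(cograph)` over `A = C(K)`, as a space. -/
abbrev XMod (γ : Fin N → C(K, K)) : Type _ := C(cograph γ, ℂ)

/-- The free Hilbert module `Y_{γ^n} = A^{N^n} = C(K, ℂ^{N^n})` over `A = C(K)`. -/
abbrev YMod (K : Type*) [TopologicalSpace K] (N n : ℕ) : Type _ :=
  C(K, EuclideanSpace ℂ (Fin n → Fin N))

/-- `L(Y_{γ^n}) = M_{N^n}(A) = C(K, M_{N^n}(ℂ))`. -/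
abbrev MatAlg (K : Type*) [TopologicalSpace K] (N n : ℕ) : Type _ := C(K, Mat N n)

/-- The `A`-valued inner product of `Y_{γ^n}`, conjugate linear in the first variable. -/
def innerA {n : ℕ} (x y : YMod K N n) : C(K, ℂ) where
  toFun t := inner ℂ (x t) (y t)
  continuous_toFun := by fun_prop

/-- The left action of `A` on `Y_{γ^n}`: `(a · f)_w(y) = a(γ_w(y)) f_w(y)`. -/
def leftAct (γ : Fin N → C(K, K)) {n : ℕ} (a : C(K, ℂ)) (f : YMod K N n) : YMod K N n where
  toFun t := WithLp.toLp 2 fun w => a (wordMap γ w t) * f t w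
  continuous_toFun := by fun_prop

/-- The pointwise action of `M_{N^n}(A)` on `Y_{γ^n}`. -/
def matAct {n : ℕ} (M : MatAlg K N n) (f : YMod K N n) : YMod K N n where
  toFun t := WithLp.toLp 2 (Matrix.mulVec (M t) (f t).ofLp)
  continuous_toFun := by fun_prop

/-- The map `φ : X_γ → Y_γ`, `φ(f)(y) = (f(γ_0(y), y), …, f(γ_{N-1}(y), y))`. -/
def phi (γ : Fin N → C(K, K)) (f : XMod γ) : YMod K N 1 where
  toFun t := WithLp.toLp 2 fun w => f ⟨(γ (w 0) t, t), w 0, t, rfl⟩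
  continuous_toFun := by fun_prop

/-- The tensor `ξ ⊗ η ∈ Y_{γ^n}` of `ξ ∈ Y_{γ^s}` and `η ∈ Y_{γ^r}`, `n = r + s`. The left action
on `η` moves the base point of `ξ`, so the letters of `η` come first. -/
def tensor (γ : Fin N → C(K, K)) {r s n : ℕ} (hn : r + s = n) (ξ : YMod K N s) (η : YMod K N r) :
    YMod K N n where
  toFun t := WithLp.toLp 2 fun w =>
    η t (pre hn w) * ξ (wordMap γ (pre hn w) t) (suf hn w)
  continuous_toFun := by fun_prop


instance {n : ℕ} : ContinuousConstSMul C(K, ℂ) (YMod K N n) where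
  continuous_const_smul a := by
    refine LipschitzWith.continuous (K := ‖a‖₊) (LipschitzWith.of_dist_le_mul fun x y => ?_)
    rw [ContinuousMap.dist_le (by positivity)]
    intro t
    have h1 : (a • x) t = a t • x t := rfl
    have h2 : (a • y) t = a t • y t := rfl
    rw [h1, h2, dist_eq_norm, ← smul_sub, norm_smul, dist_eq_norm]
    exact mul_le_mul (a.norm_coe_le_norm t) ((x - y).norm_coe_le_norm t) (norm_nonneg _)
      (norm_nonneg _)

instance {n : ℕ} : IsScalarTower ℂ C(K, ℂ) (YMod K N n) where
  smul_assoc c a x := by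
    ext t w
    change (c • a t) * x t w = c * (a t * x t w)
    simp [mul_assoc]

/-- `X_γ^{⊗ n}`. One has `X^{⊗ 0} = A`, and `X^{⊗ (n+1)} = X^{⊗ n} ⊗_A X` is the completion of the
algebraic tensor product for the `A`-valued inner product
`(ξ ⊗ f | ξ' ⊗ f') = (f | (ξ | ξ')_A · f')_A`; since `ξ ⊗ f ↦ tensor ξ (φ f)` preserves inner
products (`innerA_tensor`), the completion is the closure of its image in `Y_{γ^{n+1}}`. In this
realization the isomorphism `φ` of `X_γ^{⊗ n}` with `Z_{γ^n} ⊆ Y_{γ^n}` is the inclusion. -/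
def XPow (γ : Fin N → C(K, K)) : (n : ℕ) → Submodule C(K, ℂ) (YMod K N n)
  | 0 => ⊤
  | n + 1 => (Submodule.span C(K, ℂ)
      {ζ | ∃ ξ ∈ XPow γ n, ∃ f : XMod γ, ζ = tensor γ (Nat.add_comm 1 n) ξ (phi γ f)}).topologicalClosure

theorem innerA_phi (γ : Fin N → C(K, K)) (f g : XMod γ) (y : K) :
    innerA (phi γ f) (phi γ g) y =
      ∑ j, star (f ⟨(γ j y, y), j, y, rfl⟩) * g ⟨(γ j y, y), j, y, rfl⟩ := by
  change inner ℂ (phi γ f y) (phi γ g y) = _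
  rw [PiLp.inner_apply, ← (Equiv.funUnique (Fin 1) (Fin N)).symm.sum_comp]
  exact Finset.sum_congr rfl fun j _ => mul_comm _ _

/-- Words of length `n = r + s` are pairs of words of lengths `r` and `s`. -/
def splitEquiv {N r s n : ℕ} (hn : r + s = n) :
    (Fin n → Fin N) ≃ (Fin r → Fin N) × (Fin s → Fin N) where
  toFun w := (pre hn w, suf hn w)
  invFun v := fun k => if h : (k : ℕ) < r then v.1 ⟨k, h⟩ else v.2 ⟨k - r, by have := k.2; omega⟩
  left_inv w := by
    funext k
    by_cases h : (k : ℕ) < r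
    · simp [h, pre]
    · have : r + ((k : ℕ) - r) = k := by omega
      simp [h, suf, this]
  right_inv v := by
    refine Prod.ext ?_ ?_ <;> funext k
    · simp [pre]
    · simp [suf]

theorem innerA_tensor (γ : Fin N → C(K, K)) {r s n : ℕ} (hn : r + s = n) (ξ ξ' : YMod K N s)
    (η η' : YMod K N r) :
    innerA (tensor γ hn ξ η) (tensor γ hn ξ' η') = innerA η (leftAct γ (innerA ξ ξ') η') := by
  ext y
  simp only [innerA, tensor, leftAct, PiLp.inner_apply, ContinuousMap.coe_mk, RCLike.inner_apply]
  rw [← (splitEquiv hn).symm.sum_comp, Fintype.sum_prod_type]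
  refine Finset.sum_congr rfl fun v _ => ?_
  rw [Finset.sum_mul, Finset.sum_mul]
  refine Finset.sum_congr rfl fun u _ => ?_
  have h1 : pre hn ((splitEquiv hn).symm (v, u)) = v :=
    congrArg Prod.fst ((splitEquiv hn).apply_symm_apply (v, u))
  have h2 : suf hn ((splitEquiv hn).symm (v, u)) = u :=
    congrArg Prod.snd ((splitEquiv hn).apply_symm_apply (v, u))
  rw [h1, h2, map_mul]
  ring

/-- The rank one operator `θ^Y_{x,y} = [x_i \overline{y_j}]` in `M_{N^n}(A)`. -/
def rankOneY {n : ℕ} (x y : YMod K N n) : MatAlg K N n where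
  toFun t := Matrix.vecMulVec (x t).ofLp (star (y t).ofLp)
  continuous_toFun := by
    refine continuous_matrix fun i j => ?_
    simp only [Matrix.vecMulVec_apply, Pi.star_apply]
    fun_prop

theorem matAct_rankOneY {n : ℕ} (x y z : YMod K N n) :
    matAct (rankOneY x y) z = innerA y z • x := by
  ext t w
  change (Matrix.mulVec (Matrix.vecMulVec (x t).ofLp (star (y t).ofLp)) (z t).ofLp) w
    = inner ℂ (y t) (z t) * x t w
  simp only [Matrix.mulVec, dotProduct, Matrix.vecMulVec_apply, PiLp.inner_apply,
    RCLike.inner_apply, Finset.sum_mul, Pi.star_apply]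
  refine Finset.sum_congr rfl fun i _ => ?_
  change _ * star _ * _ = _ * star _ * _
  ring

theorem norm_innerA_smul_le {n : ℕ} (x y z : YMod K N n) :
    ‖innerA y z • x‖ ≤ ‖y‖ * ‖x‖ * ‖z‖ := by
  rw [ContinuousMap.norm_le _ (by positivity)]
  intro t
  change ‖inner ℂ (y t) (z t) • x t‖ ≤ _
  rw [norm_smul]
  calc _ ≤ (‖y t‖ * ‖z t‖) * ‖x t‖ := by gcongr; exact norm_inner_le_norm _ _
    _ ≤ (‖y‖ * ‖z‖) * ‖x‖ := by
      gcongr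
      exacts [y.norm_coe_le_norm t, z.norm_coe_le_norm t, x.norm_coe_le_norm t]
    _ = _ := by ring

/-- `X_γ^{⊗ n}` as a complex Banach space. -/
def XSpace (γ : Fin N → C(K, K)) (n : ℕ) : Type _ := XPow γ n

instance (γ : Fin N → C(K, K)) (n : ℕ) : NormedAddCommGroup (XSpace γ n) :=
  Submodule.normedAddCommGroup (XPow γ n)

instance (γ : Fin N → C(K, K)) (n : ℕ) : NormedSpace ℂ (XSpace γ n) :=
  Submodule.normedSpace ((XPow γ n).restrictScalars ℂ)

instance (γ : Fin N → C(K, K)) (n : ℕ) : CompleteSpace (XSpace γ n) := by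
  have h : IsClosed (XPow γ n : Set (YMod K N n)) := by
    cases n with
    | zero => exact isClosed_univ
    | succ n => exact Submodule.isClosed_topologicalClosure _
  exact h.completeSpace_coe

/-- The inclusion `φ : X_γ^{⊗ n} → Y_{γ^n}`. -/
def toY (γ : Fin N → C(K, K)) {n : ℕ} (x : XSpace γ n) : YMod K N n := x.1

/-- The rank one operator `θ^X_{x,y}(z) = x (y | z)_A` on `X_γ^{⊗ n}`. -/
def rankOneX (γ : Fin N → C(K, K)) {n : ℕ} (x y : XSpace γ n) : XSpace γ n →L[ℂ] XSpace γ n :=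
  LinearMap.mkContinuous
    { toFun := fun z => ⟨innerA (toY γ y) (toY γ z) • toY γ x, (XPow γ n).smul_mem _ x.2⟩
      map_add' := fun z z' => Subtype.ext <| by
        have : innerA (toY γ y) (toY γ (z + z')) =
            innerA (toY γ y) (toY γ z) + innerA (toY γ y) (toY γ z') := by
          ext t; exact inner_add_right (toY γ y t) (toY γ z t) (toY γ z' t)
        change innerA (toY γ y) (toY γ (z + z')) • toY γ x =
          innerA (toY γ y) (toY γ z) • toY γ x + innerA (toY γ y) (toY γ z') • toY γ x
        rw [this]
        ext t w
        exact add_mul (innerA (toY γ y) (toY γ z) t) (innerA (toY γ y) (toY γ z') t) (toY γ x t w)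
      map_smul' := fun c z => Subtype.ext <| by
        have : innerA (toY γ y) (toY γ (c • z)) = c • innerA (toY γ y) (toY γ z) := by
          ext t; exact inner_smul_right (toY γ y t) (toY γ z t) c
        change innerA (toY γ y) (toY γ (c • z)) • toY γ x =
          c • innerA (toY γ y) (toY γ z) • toY γ x
        rw [this, smul_assoc] }
    (‖toY γ y‖ * ‖toY γ x‖)
    fun z => norm_innerA_smul_le (toY γ x) (toY γ y) (toY γ z)

/-- The algebra `K(X_γ^{⊗ n})` of compact operators: the closed linear span of the rank one
operators on `X_γ^{⊗ n}`. -/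
def compactOps (γ : Fin N → C(K, K)) (n : ℕ) : Submodule ℂ (XSpace γ n →L[ℂ] XSpace γ n) :=
  (Submodule.span ℂ (Set.range fun z : XSpace γ n × XSpace γ n =>
    rankOneX γ z.1 z.2)).topologicalClosure

/-- The closed linear span of the pairs `(θ^X_{x,y}, θ^Y_{φ(x),φ(y)})`. -/
def omegaGraph (γ : Fin N → C(K, K)) (n : ℕ) :
    Submodule ℂ ((XSpace γ n →L[ℂ] XSpace γ n) × MatAlg K N n) :=
  (Submodule.span ℂ (Set.range fun z : XSpace γ n × XSpace γ n =>
    (rankOneX γ z.1 z.2, rankOneY (toY γ z.1) (toY γ z.2)))).topologicalClosure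

theorem omegaGraph_norm_le (γ : Fin N → C(K, K)) (n : ℕ)
    {z : (XSpace γ n →L[ℂ] XSpace γ n) × MatAlg K N n} (hz : z ∈ omegaGraph γ n) :
    ‖z.2‖ ≤ ‖z.1‖ := by
  have hcl : IsClosed {z : (XSpace γ n →L[ℂ] XSpace γ n) × MatAlg K N n | ‖z.2‖ ≤ ‖z.1‖} :=
    isClosed_le (by fun_prop) (by fun_prop)
  refine closure_minimal ?_ hcl hz
  intro z hz
  -- on the span, `M` acts on `X` as `T`, and `M*` maps `Y` into `X`
  have key : (∀ x : XSpace γ n, matAct z.2 (toY γ x) = toY γ (z.1 x)) ∧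
      ∀ y : YMod K N n, matAct (star z.2) y ∈ XPow γ n := by
    induction hz using Submodule.span_induction with
    | mem z hz =>
      obtain ⟨⟨x, y⟩, rfl⟩ := hz
      refine ⟨fun w => matAct_rankOneY _ _ _, fun w => ?_⟩
      have : star (rankOneY (toY γ x) (toY γ y)) = rankOneY (toY γ y) (toY γ x) := by
        ext t i j
        change star (toY γ x t j * star (toY γ y t i)) = toY γ y t i * star (toY γ x t j)
        simp [mul_comm]
      rw [this, matAct_rankOneY]
      exact (XPow γ n).smul_mem _ y.2
    | zero =>
      refine ⟨fun x => ?_, fun y => ?_⟩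
      · ext t w
        change Matrix.mulVec (0 : Mat N n) _ w = 0
        simp
      · have : matAct (star (0 : MatAlg K N n)) y = 0 := by
          ext t w
          change Matrix.mulVec (star (0 : Mat N n)) _ w = 0
          simp
        exact this ▸ Submodule.zero_mem _
    | add a b _ _ ha hb =>
      refine ⟨fun x => ?_, fun y => ?_⟩
      · have : matAct (a + b).2 (toY γ x) = matAct a.2 (toY γ x) + matAct b.2 (toY γ x) := by
          ext t w
          change Matrix.mulVec (a.2 t + b.2 t) _ w = Matrix.mulVec _ _ w + Matrix.mulVec _ _ w
          rw [Matrix.add_mulVec]; rfl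
        rw [this, ha.1, hb.1]; rfl
      · have : matAct (star (a + b).2) y = matAct (star a.2) y + matAct (star b.2) y := by
          ext t w
          change Matrix.mulVec (star (a.2 t + b.2 t)) _ w
            = Matrix.mulVec (star (a.2 t)) _ w + Matrix.mulVec (star (b.2 t)) _ w
          rw [star_add, Matrix.add_mulVec]; rfl
        exact this ▸ Submodule.add_mem _ (ha.2 y) (hb.2 y)
    | smul c a _ ha =>
      refine ⟨fun x => ?_, fun y => ?_⟩
      · have : matAct (c • a).2 (toY γ x) = c • matAct a.2 (toY γ x) := by
          ext t w
          change Matrix.mulVec (c • a.2 t) _ w = c • Matrix.mulVec _ _ w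
          rw [Matrix.smul_mulVec]; rfl
        rw [this, ha.1]; rfl
      · have : matAct (star (c • a).2) y = star c • matAct (star a.2) y := by
          ext t w
          change Matrix.mulVec (star (c • a.2 t)) _ w
            = star c • Matrix.mulVec (star (a.2 t)) _ w
          rw [star_smul, Matrix.smul_mulVec]; rfl
        exact this ▸ ((XPow γ n).restrictScalars ℂ).smul_mem _ (ha.2 y)
  obtain ⟨T, M⟩ := z
  obtain ⟨h1, h2⟩ := key
  change ‖M‖ ≤ ‖T‖
  have hMM : ∀ t, ‖M t‖ * ‖M t‖ ≤ ‖T‖ * ‖M‖ := fun t => by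
    have hs : ‖M t‖ * ‖M t‖ = ‖M t * (M t)ᴴ‖ := by
      have := Matrix.l2_opNorm_conjTranspose_mul_self (M t)ᴴ
      rw [Matrix.conjTranspose_conjTranspose, Matrix.l2_opNorm_conjTranspose] at this
      exact this.symm
    rw [hs, Matrix.cstar_norm_def]
    refine ContinuousLinearMap.opNorm_le_bound _ (by positivity) fun v => ?_
    let V : YMod K N n := ContinuousMap.const K v
    let x : XSpace γ n := ⟨matAct (star M) V, h2 V⟩
    have e1 : Matrix.toEuclideanCLM (𝕜 := ℂ) (M t * (M t)ᴴ) v = toY γ (T x) t := by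
      rw [← h1 x]
      ext w
      change Matrix.mulVec (M t * (M t)ᴴ) v.ofLp w
        = Matrix.mulVec (M t) (Matrix.mulVec ((M t)ᴴ) v.ofLp) w
      rw [Matrix.mulVec_mulVec]
    have e2 : ‖x‖ ≤ ‖M‖ * ‖v‖ := by
      refine (ContinuousMap.norm_le (matAct (star M) V) (by positivity)).2 fun u => ?_
      refine (Matrix.l2_opNorm_mulVec ((M u)ᴴ) v).trans ?_
      rw [Matrix.l2_opNorm_conjTranspose]
      exact mul_le_mul_of_nonneg_right (M.norm_coe_le_norm u) (norm_nonneg _)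
    rw [e1]
    calc ‖toY γ (T x) t‖ ≤ ‖T x‖ := (toY γ (T x)).norm_coe_le_norm t
      _ ≤ ‖T‖ * ‖x‖ := T.le_opNorm x
      _ ≤ ‖T‖ * (‖M‖ * ‖v‖) := mul_le_mul_of_nonneg_left e2 (norm_nonneg _)
      _ = _ := by ring
  have h3 : ‖M‖ ≤ Real.sqrt (‖T‖ * ‖M‖) :=
    (ContinuousMap.norm_le M (Real.sqrt_nonneg _)).2 fun t =>
      Real.le_sqrt_of_sq_le (by rw [sq]; exact hMM t)
  have h4 : ‖M‖ * ‖M‖ ≤ ‖T‖ * ‖M‖ := by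
    calc ‖M‖ * ‖M‖ ≤ Real.sqrt (‖T‖ * ‖M‖) * Real.sqrt (‖T‖ * ‖M‖) :=
          mul_self_le_mul_self (norm_nonneg _) h3
      _ = _ := Real.mul_self_sqrt (by positivity)
  rcases (norm_nonneg M).eq_or_lt with h0 | h0
  · exact h0 ▸ norm_nonneg _
  · exact le_of_mul_le_mul_right h4 h0

theorem existsUnique_omega (γ : Fin N → C(K, K)) (n : ℕ) (T : compactOps γ n) :
    ∃! M : MatAlg K N n, ((T : XSpace γ n →L[ℂ] XSpace γ n), M) ∈ omegaGraph γ n := by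
  refine existsUnique_of_exists_of_unique ?_ ?_
  · let G := omegaGraph γ n
    have hG : IsClosed (G : Set ((XSpace γ n →L[ℂ] XSpace γ n) × MatAlg K N n)) :=
      Submodule.isClosed_topologicalClosure _
    have : CompleteSpace G := hG.completeSpace_coe
    let g : G → (XSpace γ n →L[ℂ] XSpace γ n) := fun z => z.1.1
    have hanti : AntilipschitzWith 1 g := AntilipschitzWith.of_le_mul_dist fun a b => by
      have := omegaGraph_norm_le γ n (G.sub_mem a.2 b.2)
      rw [NNReal.coe_one, one_mul, Subtype.dist_eq, dist_eq_norm, dist_eq_norm, Prod.norm_def]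
      exact max_le le_rfl this
    have hu : UniformContinuous g := uniformContinuous_fst.comp uniformContinuous_subtype_val
    have hr : IsClosed (Set.range g) := hanti.isClosed_range hu
    have hle : ((Submodule.span ℂ (Set.range fun z : XSpace γ n × XSpace γ n =>
        rankOneX γ z.1 z.2) : Submodule ℂ _) : Set _) ⊆ Set.range g := by
      have : Submodule.span ℂ (Set.range fun z : XSpace γ n × XSpace γ n =>
          rankOneX γ z.1 z.2) ≤ G.map (LinearMap.fst ℂ _ _) := by
        rw [Submodule.span_le]
        rintro _ ⟨z, rfl⟩
        exact ⟨_, Submodule.le_topologicalClosure _ (Submodule.subset_span ⟨z, rfl⟩), rfl⟩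
      intro S hS
      obtain ⟨z, hz, rfl⟩ := this hS
      exact ⟨⟨z, hz⟩, rfl⟩
    obtain ⟨z, hz⟩ := closure_minimal hle hr T.2
    refine ⟨z.1.2, ?_⟩
    rw [← hz]
    exact z.2
  · intro M M' h h'
    have := omegaGraph_norm_le γ n (Submodule.sub_mem _ h h')
    simpa [sub_eq_zero] using this

/-- `Ω^{(n)} : K(X_γ^{⊗ n}) → M_{N^n}(A)`, the continuous linear map with
`Ω^{(n)}(θ^X_{x,y}) = θ^Y_{φ(x),φ(y)}`. -/
def Omega (γ : Fin N → C(K, K)) (n : ℕ) (T : compactOps γ n) : MatAlg K N n :=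
  (existsUnique_omega γ n T).choose

theorem Omega_rankOneX (γ : Fin N → C(K, K)) (n : ℕ) (x y : XSpace γ n) :
    Omega γ n ⟨rankOneX γ x y, Submodule.le_topologicalClosure _
      (Submodule.subset_span ⟨(x, y), rfl⟩)⟩ = rankOneY (toY γ x) (toY γ y) :=
  ((existsUnique_omega γ n _).choose_spec.2 _ (Submodule.le_topologicalClosure _
    (Submodule.subset_span ⟨(x, y), rfl⟩))).symm

/-- The embedding `T ↦ T ⊗ I_r` of `L(Y_{γ^s})` into `L(Y_{γ^n})`, `n = r + s`: the fiber of `T ⊗ I_r`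
at `y` is block diagonal with the blocks `T(γ_v(y))`, `v` a word of length `r`. -/
def amplify (γ : Fin N → C(K, K)) {r s n : ℕ} (hn : r + s = n) (T : MatAlg K N s) :
    MatAlg K N n where
  toFun y := ∑ v : Fin r → Fin N, blockEmb hn v (T (wordMap γ v y))
  continuous_toFun := by
    refine continuous_finsetSum _ fun v _ => continuous_matrix fun a b => ?_
    unfold blockEmb
    split_ifs
    · exact ((T.continuous.comp (wordMap γ v).continuous).matrix_elem _ _)
    · exact continuous_const

theorem matAct_amplify_tensor (γ : Fin N → C(K, K)) {r s n : ℕ} (hn : r + s = n)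
    (T : MatAlg K N s) (ξ : YMod K N s) (η : YMod K N r) :
    matAct (amplify γ hn T) (tensor γ hn ξ η) = tensor γ hn (matAct T ξ) η := by
  ext y a
  change ∑ b, (∑ v : Fin r → Fin N, blockEmb hn v (T (wordMap γ v y))) a b *
      (η y (pre hn b) * ξ (wordMap γ (pre hn b) y) (suf hn b))
    = η y (pre hn a) * ∑ u, T (wordMap γ (pre hn a) y) (suf hn a) u *
      ξ (wordMap γ (pre hn a) y) u
  rw [← (splitEquiv hn).symm.sum_comp, Fintype.sum_prod_type]
  have h1 : ∀ (v : Fin r → Fin N) (u : Fin s → Fin N),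
      pre hn ((splitEquiv hn).symm (v, u)) = v := fun v u =>
    congrArg Prod.fst ((splitEquiv hn).apply_symm_apply (v, u))
  have h2 : ∀ (v : Fin r → Fin N) (u : Fin s → Fin N),
      suf hn ((splitEquiv hn).symm (v, u)) = u := fun v u =>
    congrArg Prod.snd ((splitEquiv hn).apply_symm_apply (v, u))
  rw [Finset.sum_eq_single (pre hn a)]
  · rw [Finset.mul_sum]
    refine Finset.sum_congr rfl fun u _ => ?_
    rw [Matrix.sum_apply, Finset.sum_eq_single (pre hn a)]
    · simp only [blockEmb, h1, h2, and_self, if_true]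
      ring
    · intro v _ hv
      simp [blockEmb, h1, hv.symm]
    · simp
  · intro v _ hv
    refine Finset.sum_eq_zero fun u _ => ?_
    rw [Matrix.sum_apply, Finset.sum_eq_zero, zero_mul]
    intro w _
    unfold blockEmb
    rw [if_neg]
    rw [h1]
    rintro ⟨h, h'⟩
    exact hv (h'.trans h.symm)
  · simp

/-- `Π^{(n)}(T ⊗ I) = Ω^{(n,s)}(T) = Ω^{(s)}(T) ⊗ I_{n-s}` for `T ∈ K(X_γ^{⊗ s})`, `s ≤ n`. -/
def PiRep (γ : Fin N → C(K, K)) {s n : ℕ} (hs : s ≤ n) (T : compactOps γ s) : MatAlg K N n :=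
  amplify γ (Nat.sub_add_cancel hs) (Omega γ s T)

/-- The fiber `Π^{(n)}(K(X_γ^{⊗ s}) ⊗ I)(P)`. -/
def compactFiber (γ : Fin N → C(K, K)) {s n : ℕ} (hs : s ≤ n) (P : K) : Set (Mat N n) :=
  {S | ∃ T : compactOps γ s, S = PiRep γ hs T P}

/-- The submodule `Z_{γ^n}` of `Y_{γ^n}`: for `c ∈ C_{γ^n}` and `b ∈ B_{γ^n}` with `h^n(b) = c`, the
components of `f(c)` at all words `v` with `γ_v(c) = b` agree. -/
def ZSub (γ : Fin N → C(K, K)) (h : C(K, K)) (n : ℕ) : Submodule ℂ (YMod K N n) where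
  carrier := {f | ∀ c ∈ branchValueSet (wordMap γ (n := n)), ∀ b ∈ branchSet (wordMap γ (n := n)),
    h^[n] b = c → ∀ v w : Fin n → Fin N, wordMap γ v c = b → wordMap γ w c = b → f c v = f c w}
  add_mem' {f g} hf hg c hc b hb hbc v w hv hw :=
    congrArg₂ (· + ·) (hf c hc b hb hbc v w hv hw) (hg c hc b hb hbc v w hv hw)
  zero_mem' c hc b hb hbc v w hv hw := rfl
  smul_mem' a f hf c hc b hb hbc v w hv hw :=
    congrArg (a * ·) (hf c hc b hb hbc v w hv hw)

/-- The fiber `Z_{γ^n}(P) ⊆ ℂ^{N^n}`. -/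
def ZFiber (γ : Fin N → C(K, K)) (h : C(K, K)) (n : ℕ) (P : K) :
    Submodule ℂ (EuclideanSpace ℂ (Fin n → Fin N)) where
  carrier := {v | ∃ f ∈ ZSub γ h n, f P = v}
  add_mem' := by
    rintro _ _ ⟨f, hf, rfl⟩ ⟨g, hg, rfl⟩
    exact ⟨f + g, add_mem hf hg, rfl⟩
  zero_mem' := ⟨0, zero_mem _, rfl⟩
  smul_mem' := by
    rintro a _ ⟨f, hf, rfl⟩
    exact ⟨a • f, Submodule.smul_mem _ a hf, rfl⟩

/-- The matrix `Q_{γ^n}(P)` of the orthogonal projection of `ℂ^{N^n}` onto `Z_{γ^n}(P)`. -/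
def QProj (γ : Fin N → C(K, K)) (h : C(K, K)) (n : ℕ) (P : K) : Mat N n :=
  (Matrix.toEuclideanCLM (𝕜 := ℂ)).symm (ZFiber γ h n P).starProjection

open Classical in
/-- The words `i_1 ⋯ i_{p-1} i_p` with `γ_{i_{p-1}} ⋯ γ_{i_1}(P) = h(R)` and `γ_{i_p}(h(R)) = R`, i.e.
with `i_p ∈ {j(R,0), …, j(R,e_R - 1)}`: the first `p` letters of the orbits from `P` through the
branched point `R` at time `p ≥ 1`. -/
def orbitWords (γ : Fin N → C(K, K)) (h : C(K, K)) (P R : K) : (p : ℕ) → Finset (Fin p → Fin N)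
  | 0 => ∅
  | p + 1 => {w | wordMap γ (Fin.init w) P = h R ∧ γ (w (Fin.last p)) (h R) = R}

/-- The block algebra `C~(P,R,p) = {∑_l π_{q, i_1 ⋯ i_{p-1} j(R,l)}(A) | A ∈ M_{N^q}(ℂ)}` in
`M_{N^n}(ℂ)`, `n = p + q`. -/
def blockAlgTilde (γ : Fin N → C(K, K)) (h : C(K, K)) (P R : K) {p q n : ℕ} (hn : p + q = n) :
    Set (Mat N n) :=
  {S | ∃ A : Mat N q, S = ∑ w ∈ orbitWords γ h P R p, blockEmb hn w A}

/-- The block algebra `C(P,R,p) = (I - Q_{γ^n}(P)) C~(P,R,p)`. -/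
def blockAlg (γ : Fin N → C(K, K)) (h : C(K, K)) (P R : K) {p q n : ℕ} (hn : p + q = n) :
    Set (Mat N n) :=
  {S | ∃ B ∈ blockAlgTilde γ h P R hn, S = (1 - QProj γ h n P) * B}

end Modules

end SelfSim

open SelfSim

/-!
Two words of length `n` are called equivalent if their orbits from `P` have the same endpoint. The
left inverse `h` recovers every earlier point of an orbit from its endpoint, so different equivalent
words separate at a branch point of `γ` (`exists_pre_mem_branchSet`). Hence there are finitely many
branch values, and the fiber of `Z_{γ^n}` at `P` is the space of all vectors that are constant on the
equivalence classes (`mem_ZFiber`).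

Since no orbit leads from a branch point to a branch point, the words `w` of length `p` with
`γ_w(P) = R` differ at most in their last letter (`pre_eq_of_wordMap_mem_branchSet`), and the class
of `w u`, with `u` of length `q`, consists of the words `w' u` with `γ_{w'}(P) = R`
(`orbit_through_branch_point`). A matrix `B` in `C~(P,R,p)` acts in the same way on all blocks `w`
with `γ_w(P) = R` and vanishes elsewhere, so `B` and its adjoint preserve the vectors constant on
classes, and `B` commutes with the projection `Q` (`commute_QProj_sum_blockEmb`).

Sections in `X^{⊗ s}` take equal values at words with the same endpoint (`XPow_apply_eq`), so the
rows and columns of `Ω^{(s)}(T)(y)` do as well (`Omega_apply_eq`). For `q < s` the words in one class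
`{w' u}` have a common prefix of length `n - s < p`; they therefore meet the same diagonal block of
`M = Π^{(n)}(T ⊗ I)(P)`, and the rows and columns of `M` at these words agree (`PiRep_apply_eq`).
Consequently `Q B M = B M` and `M B Q = M B`, that is `(1 - Q) B M = 0` and
`M (1 - Q) B = M B (1 - Q) = 0`.
-/

namespace SelfSim

/-! ### Orbits of words -/

section Orbits

variable {K : Type*} [MetricSpace K] {N : ℕ}

theorem wordMap_suf_pre (γ : Fin N → C(K, K)) {r s n : ℕ} (hn : r + s = n) (w : Fin n → Fin N)
    (y : K) : wordMap γ (suf hn w) (wordMap γ (pre hn w) y) = wordMap γ w y := by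
  induction r generalizing n y with
  | zero =>
    obtain rfl : s = n := by omega
    have : suf hn w = w := funext fun k => congrArg w (Fin.ext (Nat.zero_add _))
    rw [this]
    rfl
  | succ r ih =>
    obtain ⟨m, rfl⟩ : ∃ m, n = m + 1 := ⟨r + s, by omega⟩
    have hm : r + s = m := by omega
    have h1 : suf hn w = suf hm (Fin.tail w) :=
      funext fun k => congrArg w (Fin.ext (by simp; omega))
    rw [h1]
    exact ih hm (Fin.tail w) (γ (w 0) y)

theorem iterate_wordMap {γ : Fin N → C(K, K)} {h : C(K, K)} (hB : AssumptionB γ h) {n : ℕ}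
    (w : Fin n → Fin N) (y : K) : h^[n] (wordMap γ w y) = y := by
  induction n generalizing y with
  | zero => rfl
  | succ n ih =>
    rw [Function.iterate_succ_apply']
    change h (h^[n] (wordMap γ (Fin.tail w) (γ (w 0) y))) = y
    rw [ih, hB.leftInverse]

theorem wordMap_pre_eq {γ : Fin N → C(K, K)} {h : C(K, K)} (hB : AssumptionB γ h) {r s n : ℕ}
    (hn : r + s = n) (w : Fin n → Fin N) (y : K) :
    wordMap γ (pre hn w) y = h^[s] (wordMap γ w y) := by
  rw [← wordMap_suf_pre γ hn w y, iterate_wordMap hB]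

/-- Two different orbits from `y` with the same endpoint pass through a branch point: compare the
words at the first letter where they differ. -/
theorem exists_pre_mem_branchSet {γ : Fin N → C(K, K)} {h : C(K, K)} (hB : AssumptionB γ h) {n : ℕ}
    {v w : Fin n → Fin N} (hvw : v ≠ w) {y : K} (he : wordMap γ v y = wordMap γ w y) :
    ∃ (k l : ℕ) (hkl : k + l = n), 1 ≤ k ∧ wordMap γ (pre hkl v) y ∈ branchSet γ := by
  induction n generalizing y with
  | zero => exact absurd (Subsingleton.elim v w) hvw
  | succ n ih =>
    by_cases h0 : v 0 = w 0
    · have ht : Fin.tail v ≠ Fin.tail w := fun ht =>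
        hvw (by rw [← Fin.cons_self_tail v, ← Fin.cons_self_tail w, ht, h0])
      have he' : wordMap γ (Fin.tail v) (γ (v 0) y) = wordMap γ (Fin.tail w) (γ (v 0) y) := by
        conv_rhs => rw [h0]
        exact he
      obtain ⟨k, l, hkl, -, hb⟩ := ih ht he'
      exact ⟨k + 1, l, by omega, by omega, hb⟩
    · refine ⟨1, n, Nat.add_comm 1 n, le_rfl, y, v 0, w 0, h0, rfl, ?_⟩
      change γ (v 0) y = γ (w 0) y
      have := congrArg h^[n] he
      change h^[n] (wordMap γ (Fin.tail v) (γ (v 0) y))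
        = h^[n] (wordMap γ (Fin.tail w) (γ (w 0) y)) at this
      rwa [iterate_wordMap hB, iterate_wordMap hB] at this

theorem finite_branchValueSet_wordMap {γ : Fin N → C(K, K)} {h : C(K, K)} (hB : AssumptionB γ h)
    (n : ℕ) : (branchValueSet (wordMap γ (n := n))).Finite := by
  refine ((Set.finite_Iic n).biUnion fun k _ => hB.finite_branchSet.image h^[k]).subset ?_
  rintro c ⟨v, w, hvw, he⟩
  obtain ⟨k, l, hkl, -, hb⟩ := exists_pre_mem_branchSet hB hvw he
  exact Set.mem_biUnion (show k ∈ Set.Iic n from by simp; omega) ⟨_, hb, iterate_wordMap hB _ _⟩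

/-- No nontrivial orbit leads from a branch point to a branch point. -/
theorem wordMap_notMem_branchSet {γ : Fin N → C(K, K)} {h : C(K, K)} (hB : AssumptionB γ h) {b : K}
    (hb : b ∈ branchSet γ) {k : ℕ} (hk : 1 ≤ k) (w : Fin k → Fin N) :
    wordMap γ w b ∉ branchSet γ := fun hw =>
  (Set.eq_empty_iff_forall_notMem.1 hB.disjoint b) ⟨hb, k, hk, w, hw⟩

theorem injective_wordMap_apply {γ : Fin N → C(K, K)} {h : C(K, K)} (hB : AssumptionB γ h) {b : K}
    (hb : b ∈ branchSet γ) {k : ℕ} : Function.Injective fun w : Fin k → Fin N => wordMap γ w b := by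
  intro v w he
  by_contra hvw
  obtain ⟨k, l, hkl, hk, hb'⟩ := exists_pre_mem_branchSet hB hvw he
  exact wordMap_notMem_branchSet hB hb hk _ hb'

/-- Orbits that arrive at a branch point at time `p` agree before time `p`. -/
theorem pre_eq_of_wordMap_mem_branchSet {γ : Fin N → C(K, K)} {h : C(K, K)} (hB : AssumptionB γ h)
    {r t p : ℕ} (hp : r + t = p) (ht : 1 ≤ t) {v w : Fin p → Fin N} {y : K}
    (hv : wordMap γ v y ∈ branchSet γ) (he : wordMap γ v y = wordMap γ w y) :
    pre hp v = pre hp w := by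
  by_contra hvw
  have he' : wordMap γ (pre hp v) y = wordMap γ (pre hp w) y := by
    rw [wordMap_pre_eq hB, wordMap_pre_eq hB, he]
  obtain ⟨k, l, hkl, -, hb⟩ := exists_pre_mem_branchSet hB hvw he'
  have hk : k + (l + t) = p := by omega
  refine wordMap_notMem_branchSet hB hb (by omega : 1 ≤ l + t) (suf hk v) ?_
  have := wordMap_suf_pre γ hk v y
  rwa [← this] at hv

theorem mem_orbitWords {γ : Fin N → C(K, K)} {h : C(K, K)} (hB : AssumptionB γ h) {P R : K}
    {p : ℕ} (hp : 1 ≤ p) (w : Fin p → Fin N) :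
    w ∈ orbitWords γ h P R p ↔ wordMap γ w P = R := by
  obtain ⟨p, rfl⟩ : ∃ m, p = m + 1 := ⟨p - 1, by omega⟩
  have key : γ (w (Fin.last p)) (wordMap γ (Fin.init w) P) = wordMap γ w P :=
    wordMap_suf_pre γ (r := p) (s := 1) rfl w P
  simp only [orbitWords, Finset.mem_filter, Finset.mem_univ, true_and]
  constructor
  · rintro ⟨h1, h2⟩
    rw [← key, h1, h2]
  · rintro rfl
    have : wordMap γ (Fin.init w) P = h (wordMap γ w P) := by rw [← key, hB.leftInverse]
    exact ⟨this, by rw [← this, key]⟩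

/-- If two words of length `p + q` have the same endpoint and the first passes through the branch
point `R` at time `p`, then so does the second, and both have the same last `q` letters. -/
theorem orbit_through_branch_point {γ : Fin N → C(K, K)} {h : C(K, K)} (hB : AssumptionB γ h)
    {P R : K} (hR : R ∈ branchSet γ) {p q n : ℕ} (hn : p + q = n) {a b : Fin n → Fin N}
    (ha : wordMap γ (pre hn a) P = R) (hab : wordMap γ a P = wordMap γ b P) :
    wordMap γ (pre hn b) P = R ∧ suf hn a = suf hn b := by
  have hb : wordMap γ (pre hn b) P = R := by
    rw [wordMap_pre_eq hB, ← hab, ← wordMap_pre_eq hB hn, ha]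
  refine ⟨hb, injective_wordMap_apply hB hR ?_⟩
  rw [← wordMap_suf_pre γ hn a, ← wordMap_suf_pre γ hn b, ha, hb] at hab
  exact hab

end Orbits

/-! ### Sums of diagonal blocks -/

section Blocks

variable {N : ℕ}

theorem sum_blockEmb_apply {p q n : ℕ} (hn : p + q = n) (W : Finset (Fin p → Fin N))
    (D : (Fin p → Fin N) → Mat N q) (a b : Fin n → Fin N) :
    (∑ w ∈ W, blockEmb hn w (D w)) a b =
      if pre hn a ∈ W ∧ pre hn b = pre hn a then D (pre hn a) (suf hn a) (suf hn b) else 0 := by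
  rw [Matrix.sum_apply]
  split_ifs with hc
  · rw [Finset.sum_eq_single_of_mem _ hc.1]
    · simp [blockEmb, hc.2]
    · intro w _ hw
      exact if_neg fun hh => hw hh.1.symm
  · refine Finset.sum_eq_zero fun w hw => if_neg ?_
    rintro ⟨rfl, h2⟩
    exact hc ⟨hw, h2⟩

theorem conjTranspose_sum_blockEmb {p q n : ℕ} (hn : p + q = n) (W : Finset (Fin p → Fin N))
    (D : Mat N q) :
    (∑ w ∈ W, blockEmb hn w D)ᴴ = ∑ w ∈ W, blockEmb hn w Dᴴ := by
  ext a b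
  rw [Matrix.conjTranspose_apply, sum_blockEmb_apply hn W (fun _ => D),
    sum_blockEmb_apply hn W (fun _ => Dᴴ)]
  by_cases hab : pre hn a = pre hn b
  · simp [hab, apply_ite star]
  · simp [hab, Ne.symm hab]

theorem sum_blockEmb_mulVec {p q n : ℕ} (hn : p + q = n) (W : Finset (Fin p → Fin N))
    (D : Mat N q) (z : (Fin n → Fin N) → ℂ) (a : Fin n → Fin N) :
    ((∑ w ∈ W, blockEmb hn w D) *ᵥ z) a =
      if pre hn a ∈ W then ∑ u, D (suf hn a) u * z ((splitEquiv hn).symm (pre hn a, u)) else 0 := by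
  have h1 : ∀ (v : Fin p → Fin N) (u : Fin q → Fin N),
      pre hn ((splitEquiv hn).symm (v, u)) = v := fun v u =>
    congrArg Prod.fst ((splitEquiv hn).apply_symm_apply (v, u))
  have h2 : ∀ (v : Fin p → Fin N) (u : Fin q → Fin N),
      suf hn ((splitEquiv hn).symm (v, u)) = u := fun v u =>
    congrArg Prod.snd ((splitEquiv hn).apply_symm_apply (v, u))
  simp only [Matrix.mulVec, dotProduct, sum_blockEmb_apply hn W (fun _ => D)]
  split_ifs with ha
  · rw [← (splitEquiv hn).symm.sum_comp, Fintype.sum_prod_type, Finset.sum_eq_single (pre hn a)]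
    · simp [h1, h2, ha]
    · intro v _ hv
      simp [h1, hv]
    · simp
  · simp [ha]

end Blocks

noncomputable section Fibers

variable {K : Type*} [MetricSpace K] [CompactSpace K] {N : ℕ}

/-! ### The fiber of `Z_{γ^n}` and its projection -/

/-- The fiber of `Z_{γ^n}` at any point `P` consists of the vectors that identify the words with the
same endpoint. The other branch values form a finite set, so such a vector extends to a section
supported off them. -/
theorem mem_ZFiber {γ : Fin N → C(K, K)} {h : C(K, K)} (hB : AssumptionB γ h) {n : ℕ} {P : K}
    {z : EuclideanSpace ℂ (Fin n → Fin N)} :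
    z ∈ ZFiber γ h n P ↔ ∀ a b, wordMap γ a P = wordMap γ b P → z a = z b := by
  constructor
  · rintro ⟨f, hf, rfl⟩ a b hab
    by_cases hne : a = b
    · rw [hne]
    · exact hf P ⟨a, b, hne, hab⟩ _ ⟨P, a, b, hne, rfl, hab⟩ (iterate_wordMap hB _ _) a b rfl
        hab.symm
  · intro hz
    have hC : IsClosed (branchValueSet (wordMap γ (n := n)) \ {P}) :=
      ((finite_branchValueSet_wordMap hB n).subset Set.sdiff_subset).isClosed
    obtain ⟨g, hg0, hg1, -⟩ := exists_continuous_zero_one_of_isClosed hC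
      (isClosed_singleton (x := P)) (Set.disjoint_sdiff_left)
    refine ⟨⟨fun t => (g t : ℂ) • z, by fun_prop⟩, ?_, ?_⟩
    · intro c hc b hb hbc v w hv hw
      by_cases hcP : c = P
      · subst hcP
        exact congrArg ((g c : ℂ) * ·) (hz v w (hv.trans hw.symm))
      · have : g c = 0 := hg0 ⟨hc, hcP⟩
        change (g c : ℂ) * z v = (g c : ℂ) * z w
        simp [this]
    · have : g P = 1 := hg1 rfl
      change (g P : ℂ) • z = z
      simp [this]

theorem toLp_QProj_mulVec (γ : Fin N → C(K, K)) (h : C(K, K)) {n : ℕ} (P : K)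
    (z : (Fin n → Fin N) → ℂ) :
    WithLp.toLp 2 (QProj γ h n P *ᵥ z) = (ZFiber γ h n P).starProjection (WithLp.toLp 2 z) := by
  have : Matrix.toEuclideanCLM (𝕜 := ℂ) (QProj γ h n P) = (ZFiber γ h n P).starProjection :=
    StarAlgEquiv.apply_symm_apply _ _
  rw [← this]
  rfl

set_option synthInstance.maxHeartbeats 200000 in
theorem conjTranspose_QProj (γ : Fin N → C(K, K)) (h : C(K, K)) (n : ℕ) (P : K) :
    (QProj γ h n P)ᴴ = QProj γ h n P := by
  rw [← Matrix.star_eq_conjTranspose, QProj, ← map_star]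
  congr 1
  exact isSelfAdjoint_starProjection _

theorem QProj_mul_eq_self {γ : Fin N → C(K, K)} {h : C(K, K)} {n : ℕ} {P : K} {M : Mat N n}
    (hM : ∀ c, WithLp.toLp 2 (M.col c) ∈ ZFiber γ h n P) : QProj γ h n P * M = M := by
  ext a c
  have h1 := toLp_QProj_mulVec γ h P (M.col c)
  rw [Submodule.starProjection_eq_self_iff.2 (hM c)] at h1
  exact congrArg (fun z : EuclideanSpace ℂ (Fin n → Fin N) => z a) h1

/-- Only the values of `z` on the words that pass through `R` at time `p` matter, hence `z` has to
identify words with the same endpoint only among these. -/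
theorem sum_blockEmb_mulVec_mem_ZFiber {γ : Fin N → C(K, K)} {h : C(K, K)} (hB : AssumptionB γ h)
    {P R : K} (hR : R ∈ branchSet γ) {p q n : ℕ} (hp : 1 ≤ p) (hn : p + q = n) (D : Mat N q)
    {z : (Fin n → Fin N) → ℂ}
    (hz : ∀ a b, wordMap γ (pre hn a) P = R → wordMap γ a P = wordMap γ b P → z a = z b) :
    WithLp.toLp 2 ((∑ w ∈ orbitWords γ h P R p, blockEmb hn w D) *ᵥ z) ∈ ZFiber γ h n P := by
  rw [mem_ZFiber hB]
  intro a b hab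
  change (_ *ᵥ z) a = (_ *ᵥ z) b
  have h1 : ∀ (v : Fin p → Fin N) (u : Fin q → Fin N),
      pre hn ((splitEquiv hn).symm (v, u)) = v := fun v u =>
    congrArg Prod.fst ((splitEquiv hn).apply_symm_apply (v, u))
  have h2 : ∀ (v : Fin p → Fin N) (u : Fin q → Fin N),
      suf hn ((splitEquiv hn).symm (v, u)) = u := fun v u =>
    congrArg Prod.snd ((splitEquiv hn).apply_symm_apply (v, u))
  have hW := mem_orbitWords (P := P) (R := R) hB hp
  rw [sum_blockEmb_mulVec, sum_blockEmb_mulVec]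
  by_cases ha : wordMap γ (pre hn a) P = R
  · obtain ⟨hb, hs⟩ := orbit_through_branch_point hB hR hn ha hab
    rw [if_pos ((hW _).2 ha), if_pos ((hW _).2 hb), hs]
    refine Finset.sum_congr rfl fun u _ => congrArg _ (hz _ _ (by rw [h1, ha]) ?_)
    rw [← wordMap_suf_pre γ hn, ← wordMap_suf_pre γ hn (_ : Fin n → Fin N), h1, h1, h2, h2, ha, hb]
  · rw [if_neg (mt (hW _).1 ha), if_neg fun hb =>
      ha (orbit_through_branch_point hB hR hn ((hW _).1 hb) hab.symm).1]

theorem QProj_mul_sum_blockEmb_mul {γ : Fin N → C(K, K)} {h : C(K, K)} (hB : AssumptionB γ h)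
    {P R : K} (hR : R ∈ branchSet γ) {p q n : ℕ} (hp : 1 ≤ p) (hn : p + q = n) (D : Mat N q)
    {M : Mat N n}
    (hM : ∀ a b c, wordMap γ (pre hn a) P = R → wordMap γ a P = wordMap γ b P → M a c = M b c) :
    QProj γ h n P * ((∑ w ∈ orbitWords γ h P R p, blockEmb hn w D) * M) =
      (∑ w ∈ orbitWords γ h P R p, blockEmb hn w D) * M :=
  QProj_mul_eq_self fun c =>
    sum_blockEmb_mulVec_mem_ZFiber hB hR hp hn D (z := M.col c) fun a b => hM a b c

theorem QProj_apply_eq {γ : Fin N → C(K, K)} {h : C(K, K)} (hB : AssumptionB γ h) {n : ℕ} {P : K}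
    (a b c : Fin n → Fin N) (hab : wordMap γ a P = wordMap γ b P) :
    QProj γ h n P a c = QProj γ h n P b c := by
  have h1 := toLp_QProj_mulVec γ h P (Pi.single c (1 : ℂ))
  have h2 : WithLp.toLp 2 (QProj γ h n P *ᵥ Pi.single c (1 : ℂ)) ∈ ZFiber γ h n P :=
    h1 ▸ Submodule.starProjection_apply_mem _ _
  rw [Matrix.mulVec_single_one] at h2
  exact (mem_ZFiber hB).1 h2 a b hab

/-- The algebra `C~(P,R,p)` and its adjoints preserve the fiber of `Z_{γ^n}`, hence it commutes with
the projection onto this fiber. -/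
theorem commute_QProj_sum_blockEmb {γ : Fin N → C(K, K)} {h : C(K, K)} (hB : AssumptionB γ h)
    {P R : K} (hR : R ∈ branchSet γ) {p q n : ℕ} (hp : 1 ≤ p) (hn : p + q = n) (D : Mat N q) :
    QProj γ h n P * ∑ w ∈ orbitWords γ h P R p, blockEmb hn w D =
      (∑ w ∈ orbitWords γ h P R p, blockEmb hn w D) * QProj γ h n P := by
  have h1 := QProj_mul_sum_blockEmb_mul hB hR hp hn D (M := QProj γ h n P)
    fun a b c _ => QProj_apply_eq hB a b c
  have h2 := QProj_mul_sum_blockEmb_mul hB hR hp hn Dᴴ (M := QProj γ h n P)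
    fun a b c _ => QProj_apply_eq hB a b c
  have h3 := congrArg Matrix.conjTranspose h2
  simp only [← conjTranspose_sum_blockEmb, Matrix.conjTranspose_mul, conjTranspose_QProj,
    Matrix.conjTranspose_conjTranspose] at h3
  rw [← h3, Matrix.mul_assoc, h1]

/-! ### Fibers of compact operators -/

theorem XPow_apply_eq {γ : Fin N → C(K, K)} {h : C(K, K)} (hB : AssumptionB γ h) {n : ℕ}
    {f : YMod K N n} (hf : f ∈ XPow γ n) (y : K) (a b : Fin n → Fin N)
    (hab : wordMap γ a y = wordMap γ b y) : f y a = f y b := by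
  induction n generalizing y with
  | zero => rw [Subsingleton.elim a b]
  | succ n ih =>
    have hcl : IsClosed {f : YMod K N (n + 1) | f y a = f y b} :=
      isClosed_eq (by fun_prop) (by fun_prop)
    refine closure_minimal ?_ hcl hf
    intro f hf
    induction hf using Submodule.span_induction with
    | mem f hf =>
      obtain ⟨ξ, hξ, g, rfl⟩ := hf
      have h1 : wordMap γ (pre (Nat.add_comm 1 n) a) y = wordMap γ (pre (Nat.add_comm 1 n) b) y := by
        rw [wordMap_pre_eq hB, wordMap_pre_eq hB, hab]
      rw [← wordMap_suf_pre γ (Nat.add_comm 1 n) a, ← wordMap_suf_pre γ (Nat.add_comm 1 n) b,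
        ← h1] at hab
      have h2 : phi γ g y (pre (Nat.add_comm 1 n) a) = phi γ g y (pre (Nat.add_comm 1 n) b) :=
        congrArg g (Subtype.ext (Prod.ext h1 rfl))
      change phi γ g y (pre (Nat.add_comm 1 n) a) *
          ξ (wordMap γ (pre (Nat.add_comm 1 n) a) y) (suf (Nat.add_comm 1 n) a) =
        phi γ g y (pre (Nat.add_comm 1 n) b) *
          ξ (wordMap γ (pre (Nat.add_comm 1 n) b) y) (suf (Nat.add_comm 1 n) b)
      rw [h2, ← h1, ih hξ _ _ _ hab]
    | zero => rfl
    | add f g _ _ hf hg => exact congrArg₂ (· + ·) hf hg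
    | smul c f _ hf => exact congrArg (c y * ·) hf

theorem Omega_apply_eq {γ : Fin N → C(K, K)} {h : C(K, K)} (hB : AssumptionB γ h) {n : ℕ}
    (T : compactOps γ n) (y : K) (a b c : Fin n → Fin N) (hab : wordMap γ a y = wordMap γ b y) :
    Omega γ n T y a c = Omega γ n T y b c ∧ Omega γ n T y c a = Omega γ n T y c b := by
  have hmem := (existsUnique_omega γ n T).choose_spec.1
  change (_, Omega γ n T) ∈ omegaGraph γ n at hmem
  have hev : ∀ i j, Continuous
      fun z : (XSpace γ n →L[ℂ] XSpace γ n) × MatAlg K N n => z.2 y i j := fun i j =>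
    ((continuous_eval_const (F := MatAlg K N n) y).comp continuous_snd).matrix_elem i j
  have hcl : IsClosed {z : (XSpace γ n →L[ℂ] XSpace γ n) × MatAlg K N n |
      z.2 y a c = z.2 y b c ∧ z.2 y c a = z.2 y c b} :=
    (isClosed_eq (hev _ _) (hev _ _)).inter (isClosed_eq (hev _ _) (hev _ _))
  refine closure_minimal ?_ hcl hmem
  intro z hz
  induction hz using Submodule.span_induction with
  | mem z hz =>
    obtain ⟨⟨x, x'⟩, rfl⟩ := hz
    exact ⟨congrArg (· * star (toY γ x' y c)) (XPow_apply_eq hB x.2 y a b hab),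
      congrArg (toY γ x y c * star ·) (XPow_apply_eq hB x'.2 y a b hab)⟩
  | zero => exact ⟨rfl, rfl⟩
  | add f g _ _ hf hg => exact ⟨congrArg₂ (· + ·) hf.1 hg.1, congrArg₂ (· + ·) hf.2 hg.2⟩
  | smul t f _ hf => exact ⟨congrArg (t * ·) hf.1, congrArg (t * ·) hf.2⟩

/-- The blocks of `Π^{(n)}(T ⊗ I)(P)` are indexed by prefixes of length `n - s < p`, which are
determined by the endpoint for the words that pass through `R` at time `p`. -/
theorem PiRep_apply_eq {γ : Fin N → C(K, K)} {h : C(K, K)} (hB : AssumptionB γ h)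
    {P R : K} (hR : R ∈ branchSet γ) {p q n s : ℕ} (hn : p + q = n) (hqs : q + 1 ≤ s) (hs : s ≤ n)
    (T : compactOps γ s) (a b c : Fin n → Fin N) (ha : wordMap γ (pre hn a) P = R)
    (hab : wordMap γ a P = wordMap γ b P) :
    PiRep γ hs T P a c = PiRep γ hs T P b c ∧ PiRep γ hs T P c a = PiRep γ hs T P c b := by
  have hr : n - s + (p - (n - s)) = p := by omega
  have hb := (orbit_through_branch_point hB hR hn ha hab).1
  have hpre : pre (Nat.sub_add_cancel hs) a = pre (Nat.sub_add_cancel hs) b :=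
    pre_eq_of_wordMap_mem_branchSet hB hr (by omega) (v := pre hn a) (w := pre hn b) (y := P)
      (by rwa [ha]) (by rw [ha, hb])
  have hsuf : wordMap γ (suf (Nat.sub_add_cancel hs) a) (wordMap γ (pre (Nat.sub_add_cancel hs) a) P)
      = wordMap γ (suf (Nat.sub_add_cancel hs) b)
        (wordMap γ (pre (Nat.sub_add_cancel hs) a) P) := by
    rw [wordMap_suf_pre, hab, hpre, wordMap_suf_pre]
  have hT : ∀ i j, PiRep γ hs T P i j =
      if pre (Nat.sub_add_cancel hs) j = pre (Nat.sub_add_cancel hs) i then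
        Omega γ s T (wordMap γ (pre (Nat.sub_add_cancel hs) i) P)
          (suf (Nat.sub_add_cancel hs) i) (suf (Nat.sub_add_cancel hs) j) else 0 := fun i j => by
    have := sum_blockEmb_apply (Nat.sub_add_cancel hs) Finset.univ
      (fun v => Omega γ s T (wordMap γ v P)) i j
    simp only [Finset.mem_univ, true_and] at this
    exact this
  simp only [hT, ← hpre]
  constructor
  · rw [(Omega_apply_eq hB T _ _ _ _ hsuf).1]
  · split_ifs with hc
    · rw [← hc]
      exact (Omega_apply_eq hB T _ _ _ _ hsuf).2
    · rfl

end Fibers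

end SelfSim

open SelfSim
theorem mainTheorem11 {K : Type*} [MetricSpace K] [CompactSpace K] {N : ℕ}
    (γ : Fin N → C(K, K)) (hγ : IsSelfSimilar γ) (h : C(K, K)) (hB : AssumptionB γ h)
    (P : K) (hP : P ∈ postcriticalSet γ) (R : K) (hR : R ∈ branchSet γ)
    (n p q : ℕ) (hp : 1 ≤ p) (hn : p + q = n) (hRP : h^[p] R = P)
    (s : ℕ) (hqs : q + 1 ≤ s) (hs : s ≤ n) :
    ∀ S ∈ blockAlg γ h P R hn, ∀ T ∈ compactFiber γ hs P, S * T = 0 ∧ T * S = 0 := by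
  rintro _ ⟨_, ⟨D, rfl⟩, rfl⟩ _ ⟨T, rfl⟩
  have hrow := QProj_mul_sum_blockEmb_mul hB hR hp hn D (M := PiRep γ hs T P)
    fun a b c ha hab => (PiRep_apply_eq hB hR hn hqs hs T a b c ha hab).1
  have hcol := QProj_mul_sum_blockEmb_mul hB hR hp hn Dᴴ (M := (PiRep γ hs T P)ᴴ)
    fun a b c ha hab => congrArg star (PiRep_apply_eq hB hR hn hqs hs T a b c ha hab).2
  have hcol' := congrArg Matrix.conjTranspose hcol
  simp only [← conjTranspose_sum_blockEmb, Matrix.conjTranspose_mul, conjTranspose_QProj,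
    Matrix.conjTranspose_conjTranspose] at hcol'
  constructor
  · rw [Matrix.mul_assoc, sub_mul, one_mul, hrow, sub_self]
  · rw [sub_mul, one_mul, commute_QProj_sum_blockEmb hB hR hp hn, Matrix.mul_sub,
      ← Matrix.mul_assoc, hcol', sub_self]
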